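/- Let $N\ge 2$ and let $\beta\in\mathbb C$ be a primitive $N$-th root of unity. Consider the autonomous discrete equation $$\Phi_{n,m}:=(u_{n,m+1}+1)(u_{n,m}-1)-\beta\,(u_{n+1,m+1}-1)(u_{n+1,m}+1)=0,\qquad n,m\in\mathbb Z. \qquad (1)$$ Put $$f^{(1)}_{n,m}=(u_{n,m}^2-1)(u_{n,m+1}-u_{n,m-1}),\qquad g_{n,m}=(u_{n,m}^2-1)\big((m+1)u_{n,m+1}-(m-1)u_{n,m-1}\big),$$ and for $k\ge 1$ $$f^{(k+1)}_{n,m}=\sum_{j=-k}^{k} g_{n,m+j}\frac{\partial f^{(k)}_{n,m}}{\partial u_{n,m+j}}-\sum_{j=-1}^{1} f^{(k)}_{n,m+j}\frac{\partial g_{n,m}}{\partial u_{n,m+j}}.$$ Let the constants $c_{k,j}$ be defined by $c_{1,0}=1$, $c_{k,-1}=c_{k,k}=0$ and $c_{k+1,j}=c_{k,j}-k\,c_{k,j-1}$ for $k\ge1$, $0\le j\le k$. An equation $\partial_t u_{n,m}=h_{n,m}(u_{n,m+\mu},\dots,u_{n,m-\mu})$ with $\mu>0$ is called a generalized symmetry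 of order $\mu$ in the $m$-direction of (1) if $\partial h_{n,m}/\partial u_{n,m+\mu}\ne0$ for some $(n,m)$, $\partial h_{n,m}/\partial u_{n,m-\mu}\neq 0$ for some $(n,m)$, and, for all $n,m$, $$\sum_{i,j\in\{0,1\}}h_{n+i,m+j}\,\frac{\partial\Phi_{n,m}}{\partial u_{n+i,m+j}}=0$$ on all solutions $u:\mathbb Z^2\to\mathbb C$ of (1). It is autonomous if $h_{n,m}$ does not depend explicitly on $n$ and $m$. Then for every integer $\kappa\ge1$, with $k=\kappa N$, one has $\beta^{nk}=1$ for all $n\in\mathbb Z$, and $$\partial_{t_k}u_{n,m}=\beta^{nk}\sum_{j=0}^{k-1}4^j c_{k,j}\,f^{(k-j)}_{n,m}$$ is an autonomous generalized symmetry of (1) in the $m$-direction, of order $k=\kappa N$. -/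

import Mathlib

open MvPolynomial

noncomputable section

/-- Polynomials over `ℂ` in the lattice variables `u_{n,m}`, `(n,m) ∈ ℤ²`;
the variable `u_{n,m}` is `latticeVar n m`. -/
abbrev LatticePoly : Type := MvPolynomial (ℤ × ℤ) ℂ

/-- The variable `u_{n,m}`. -/
def latticeVar (n m : ℤ) : LatticePoly := X (n, m)

/-- The partial derivative `∂F/∂u_{n,m}`. -/
def latticeDeriv (n m : ℤ) (F : LatticePoly) : LatticePoly := pderiv (n, m) F

/-- A complex-valued function `u` on the lattice is a solution of the discrete equation
`Φ_{n,m} = 0` if it satisfies it at every point `(n,m)`. -/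
def IsLatticeSolution (Φ : ℤ → ℤ → LatticePoly) (u : ℤ × ℤ → ℂ) : Prop :=
  ∀ n m : ℤ, eval u (Φ n m) = 0

/-- `∂_t u_{n,m} = h_{n,m}(u_{n,m+μ}, …, u_{n,m-μ})` (with polynomial right-hand sides) is a
generalized symmetry of order `μ` in the `m`-direction of the discrete equation
`Φ_{n,m}(u_{n,m}, u_{n+1,m}, u_{n,m+1}, u_{n+1,m+1}) = 0`. -/
structure IsGeneralizedSymmetryM (Φ h : ℤ → ℤ → LatticePoly) (μ : ℕ) : Prop where
  order_pos : 0 < μ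
  /-- `h_{n,m}` is a function of `u_{n,m+j}`, `-μ ≤ j ≤ μ`, only. -/
  dependence : ∀ n m : ℤ, ∀ p ∈ (h n m).vars, p.1 = n ∧ m - μ ≤ p.2 ∧ p.2 ≤ m + μ
  /-- `h` depends essentially on the upper end of that range. -/
  upper : ∃ n m : ℤ, latticeDeriv n (m + μ) (h n m) ≠ 0
  /-- `h` depends essentially on the lower end of that range. -/
  lower : ∃ n m : ℤ, latticeDeriv n (m - μ) (h n m) ≠ 0
  /-- The derivative of `Φ_{n,m}` in virtue of `∂_t u_{n,m} = h_{n,m}` vanishes on all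
  solutions of the discrete equation. -/
  compatible : ∀ u : ℤ × ℤ → ℂ, IsLatticeSolution Φ u → ∀ n m : ℤ,
    eval u (∑ i ∈ ({0, 1} : Finset ℤ), ∑ j ∈ ({0, 1} : Finset ℤ),
      h (n + i) (m + j) * latticeDeriv (n + i) (m + j) (Φ n m)) = 0

/-- A family `h_{n,m}` is autonomous if it does not depend explicitly on `n` and `m`: the
polynomial `h_{n,m}` is obtained from `h_{0,0}` by replacing each `u_{i,j}` by
`u_{i+n,j+m}`. -/
def IsAutonomous (h : ℤ → ℤ → LatticePoly) : Prop :=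
  ∀ n m : ℤ, h n m = rename (fun p : ℤ × ℤ => (p.1 + n, p.2 + m)) (h 0 0)

/-- The discrete equation
`(u_{n,m+1} + 1)(u_{n,m} - 1) = β (u_{n+1,m+1} - 1)(u_{n+1,m} + 1)`, written as
`Φ_{n,m} = 0`. -/
def discreteEq (β : ℂ) (n m : ℤ) : LatticePoly :=
  (latticeVar n (m + 1) + 1) * (latticeVar n m - 1)
    - C β * ((latticeVar (n + 1) (m + 1) - 1) * (latticeVar (n + 1) m + 1))

/-- The right-hand side of the modified Volterra equation,
`(u_{n,m}² - 1)(u_{n,m+1} - u_{n,m-1})`. -/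
def mVolterra (n m : ℤ) : LatticePoly :=
  (latticeVar n m ^ 2 - 1) * (latticeVar n (m + 1) - latticeVar n (m - 1))

/-- The right-hand side of the master symmetry,
`g_{n,m} = (u_{n,m}² - 1)((m+1) u_{n,m+1} - (m-1) u_{n,m-1})`. -/
def masterSym (n m : ℤ) : LatticePoly :=
  (latticeVar n m ^ 2 - 1) *
    (C ((m : ℂ) + 1) * latticeVar n (m + 1) - C ((m : ℂ) - 1) * latticeVar n (m - 1))

/-- The functions `f^{(k)}_{n,m}`, `k ≥ 1`: `f^{(1)}` is the modified Volterra equation and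
`f^{(k+1)}_{n,m} = ∑_{j=-k}^{k} g_{n,m+j} ∂f^{(k)}_{n,m}/∂u_{n,m+j}
  - ∑_{j=-1}^{1} f^{(k)}_{n,m+j} ∂g_{n,m}/∂u_{n,m+j}`.
The value at `k = 0` is not used. -/
def mvHierarchy : ℕ → ℤ → ℤ → LatticePoly
  | 0 => fun _ _ => 0
  | 1 => mVolterra
  | (k + 2) => fun n m =>
      ∑ j ∈ Finset.Icc (-((k : ℤ) + 1)) ((k : ℤ) + 1),
          masterSym n (m + j) * latticeDeriv n (m + j) (mvHierarchy (k + 1) n m)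
        - ∑ j ∈ Finset.Icc (-1 : ℤ) 1,
            mvHierarchy (k + 1) n (m + j) * latticeDeriv n (m + j) (masterSym n m)

/-- The constants `c_{k,j}`: `c_{1,0} = 1` and `c_{k+1,j} = c_{k,j} - k c_{k,j-1}` for
`k ≥ 1`, `0 ≤ j ≤ k`, with `c_{k,-1} = c_{k,k} = 0`. The values `c_{k,j}` with `j ≥ k`
are all zero; the row `k = 0` is not used. -/
def symCoeff : ℕ → ℕ → ℤ
  | 0, _ => 0
  | 1, 0 => 1
  | 1, (_ + 1) => 0
  | (k + 2), 0 => symCoeff (k + 1) 0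
  | (k + 2), (j + 1) => symCoeff (k + 1) (j + 1) - ((k : ℤ) + 1) * symCoeff (k + 1) j

/-- The right-hand side `β^{nk} ∑_{j=0}^{k-1} 4^j c_{k,j} f^{(k-j)}_{n,m}`. -/
def symRhs (β : ℂ) (k : ℕ) (n m : ℤ) : LatticePoly :=
  C (β ^ (n * (k : ℤ))) *
    ∑ j ∈ Finset.range k, C ((4 : ℂ) ^ j * (symCoeff k j : ℂ)) * mvHierarchy (k - j) n m

end

/-!
The discrete equation says `w = β w'`, where `w_m = (u_{n,m+1} + 1) (u_{n,m} - 1)` and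
`w'_m = (u_{n+1,m+1} - 1) (u_{n+1,m} + 1)` are the two Miura transforms of neighbouring columns
(`miura 1` and `miura (-1)`). Both transformations carry the modified Volterra equation to the
Volterra equation `∂_t w_m = w_m (w_{m+1} - w_{m-1})`, and they carry the master symmetry `g` to
`G + 4 E`, where `G` is the master symmetry of the Volterra equation and `E` the scaling field
(`intertwines_miura_mvMaster`).

The recursion of the constants `c_{k,j}` means that the sums
`F_k = ∑_j 4^j c_{k,j} f^{(k-j)}` satisfy `F_{k+1} = [g, F_k] - 4k F_k`
(`sum_symCoeff_smul_mvFlow`). The Volterra flows `V_{k+1} = [G, V_k]` satisfy `[E, V_k] = k V_k`, so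
the correction `-4k F_k` is exactly what makes both Miura transformations carry `F_k` to `V_k`
(`intertwines_miura_symFlow`). Since `V_k` is homogeneous of degree `k + 1`, the relation
`w = β w'` is preserved by the flow when `β^k = 1` (`isGeneralizedSymmetryM_symFlow`).

As `g` depends explicitly on `m`, that `F_k` is autonomous needs an argument. A shift of the lattice
changes `g` by `f^{(1)}`, so it suffices that `F_k` commutes with `f^{(1)}`. A field annihilating
both Miura transforms is zero (`eq_zero_of_intertwines_miura`), so this follows if `V_k` commutes
with `V_1`. By the Jacobi identity `[V_1, V_{k+1}] = -[V_2, V_k]`, and this bracket commutes with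
`V_1` and is homogeneous of degree `k + 3`. A homogeneous field commuting with `V_1` has top
coefficient a multiple of `w_0 ⋯ w_{r-1}`, `r` being its order, which ties its degree to its order
(`eq_zero_of_volterraField_lie`); the top coefficient of `[V_2, V_k]` cancels, its order is too
small for its degree, and the bracket vanishes (`volterraField_lie_volterraFlow`).

Fields are derivations of the polynomial ring in the variables of one column, and the indices of
the flows in the Lean text start at zero: `volterraFlow k`, `mvFlow k` and `symFlow k` are
`V_{k+1}`, `f^{(k+1)}` and `F_{k+1}`.
-/

/-! ### Derivations of polynomial rings and homomorphisms that intertwine them -/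

section General

variable {σ τ : Type*}

theorem derivation_sum_apply {ι : Type*} (s : Finset ι)
    (D : ι → Derivation ℂ (MvPolynomial σ ℂ) (MvPolynomial σ ℂ)) (P : MvPolynomial σ ℂ) :
    (∑ i ∈ s, D i) P = ∑ i ∈ s, D i P := by
  classical
  induction s using Finset.induction_on with
  | empty => simp
  | insert i s hi ih => rw [Finset.sum_insert hi, Finset.sum_insert hi, Derivation.add_apply, ih]

theorem derivation_apply_eq_sum (D : Derivation ℂ (MvPolynomial σ ℂ) (MvPolynomial σ ℂ))
    (P : MvPolynomial σ ℂ) (s : Finset σ) (hs : P.vars ⊆ s) :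
    D P = ∑ i ∈ s, D (X i) * pderiv i P := by
  classical
  have h : D P = (∑ i ∈ s, D (X i) • (pderiv i :
      Derivation ℂ (MvPolynomial σ ℂ) (MvPolynomial σ ℂ))) P := by
    refine derivation_eq_of_forall_mem_vars fun j hj => ?_
    rw [derivation_sum_apply, Finset.sum_eq_single j]
    · simp
    · intro i _ hij
      simp [pderiv_X_of_ne hij.symm]
    · exact fun h => absurd (hs hj) h
  rw [h, derivation_sum_apply]
  rfl

theorem pderiv_comm (i j : σ) (P : MvPolynomial σ ℂ) :
    pderiv i (pderiv j P) = pderiv j (pderiv i P) := by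
  classical
  have h : ⁅(pderiv i : Derivation ℂ (MvPolynomial σ ℂ) (MvPolynomial σ ℂ)),
      (pderiv j : Derivation ℂ (MvPolynomial σ ℂ) (MvPolynomial σ ℂ))⁆ = 0 := by
    refine derivation_ext fun l => ?_
    rw [Derivation.commutator_apply, pderiv_X, pderiv_X, Pi.single_apply, Pi.single_apply]
    split_ifs <;> simp
  have h2 := congrArg (fun D : Derivation ℂ (MvPolynomial σ ℂ) (MvPolynomial σ ℂ) => D P) h
  simpa [Derivation.commutator_apply, sub_eq_zero] using h2

/-- If `X t` does not occur in `P`, it enters `D P` through the single term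
`D (X s) * pderiv s P` when `X s` is the only variable of `P` whose image under `D` involves it. -/
theorem pderiv_derivation_of_unique (D : Derivation ℂ (MvPolynomial σ ℂ) (MvPolynomial σ ℂ))
    (P : MvPolynomial σ ℂ) (s t : σ) (ht : pderiv t P = 0)
    (h : ∀ j ∈ P.vars, j ≠ s → pderiv t (D (X j)) = 0) :
    pderiv t (D P) = pderiv t (D (X s)) * pderiv s P := by
  classical
  have hcomm : ∀ j, pderiv t (pderiv j P) = 0 := fun j => by rw [pderiv_comm, ht, map_zero]
  rw [derivation_apply_eq_sum D P (insert s P.vars) (Finset.subset_insert _ _), map_sum,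
    Finset.sum_eq_single s]
  · rw [pderiv_mul, hcomm, mul_zero, add_zero]
  · intro j hj hjs
    rw [pderiv_mul, hcomm, mul_zero, add_zero,
      h j ((Finset.mem_insert.1 hj).resolve_left hjs) hjs, zero_mul]
  · exact fun h => absurd (Finset.mem_insert_self _ _) h

theorem notMem_vars_of_pderiv_eq_zero {P : MvPolynomial σ ℂ} {i : σ} (h : pderiv i P = 0) :
    i ∉ P.vars := by
  classical
  intro hi
  obtain ⟨d, hd, hdi⟩ := (mem_vars_iff_mem_support i).1 hi
  have hle : Finsupp.single i 1 ≤ d := by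
    rw [Finsupp.single_le_iff]
    exact Nat.one_le_iff_ne_zero.2 (Finsupp.mem_support_iff.1 hdi)
  have h1 := congrArg (coeff (d - Finsupp.single i 1)) h
  rw [coeff_pderiv, tsub_add_cancel_of_le hle, coeff_zero] at h1
  rcases mul_eq_zero.1 h1 with h2 | h2
  · exact mem_support_iff.1 hd h2
  · exact (Nat.cast_add_one_ne_zero (R := ℂ) _) h2

theorem eq_zero_of_pderiv_X_mul_eq_zero {P : MvPolynomial σ ℂ} {i : σ}
    (h : pderiv i (X i * P) = 0) : P = 0 := by
  classical
  ext d
  have h1 := congrArg (coeff d) h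
  rw [coeff_pderiv, add_comm d, coeff_X_mul, coeff_zero] at h1
  exact (mul_eq_zero.1 h1).resolve_right (Nat.cast_add_one_ne_zero _)

/-- The algebra homomorphism `φ` relates the derivations `D` and `D'`: `D ∘ φ = φ ∘ D'`.
Geometrically, the substitution described by `φ` maps the flow of `D` to the flow of `D'`. -/
def Intertwines (φ : MvPolynomial τ ℂ →ₐ[ℂ] MvPolynomial σ ℂ)
    (D : Derivation ℂ (MvPolynomial σ ℂ) (MvPolynomial σ ℂ))
    (D' : Derivation ℂ (MvPolynomial τ ℂ) (MvPolynomial τ ℂ)) : Prop :=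
  ∀ P, D (φ P) = φ (D' P)

namespace Intertwines

variable {φ : MvPolynomial τ ℂ →ₐ[ℂ] MvPolynomial σ ℂ}
  {D D₁ D₂ : Derivation ℂ (MvPolynomial σ ℂ) (MvPolynomial σ ℂ)}
  {D' D₁' D₂' : Derivation ℂ (MvPolynomial τ ℂ) (MvPolynomial τ ℂ)}

theorem of_X (h : ∀ i, D (φ (X i)) = φ (D' (X i))) : Intertwines φ D D' := by
  intro P
  induction P using MvPolynomial.induction_on with
  | C a =>
    rw [derivation_C, map_zero, ← algebraMap_eq, AlgHom.commutes, algebraMap_eq, derivation_C]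
  | add p q hp hq => simp only [map_add, hp, hq]
  | mul_X p i hp => simp only [map_mul, map_add, Derivation.leibniz, smul_eq_mul, hp, h]

theorem sub (h₁ : Intertwines φ D₁ D₁') (h₂ : Intertwines φ D₂ D₂') :
    Intertwines φ (D₁ - D₂) (D₁' - D₂') := fun P => by
  simp [h₁ P, h₂ P]

theorem smul (c : ℂ) (h : Intertwines φ D D') : Intertwines φ (c • D) (c • D') := fun P => by
  simp [h P]

theorem lie (h₁ : Intertwines φ D₁ D₁') (h₂ : Intertwines φ D₂ D₂') :
    Intertwines φ ⁅D₁, D₂⁆ ⁅D₁', D₂'⁆ := fun P => by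
  simp only [Derivation.commutator_apply, map_sub, h₁ _, h₂ _]

end Intertwines

end General

/-! ### Derivations on a one-dimensional lattice -/

/-- Polynomials in the variables `X m`, `m ∈ ℤ`, of a one-dimensional lattice. -/
abbrev ChainPoly : Type := MvPolynomial ℤ ℂ

/-- Vector fields on the one-dimensional lattice, as derivations: `D (X m)` is the velocity
of the variable `X m`. -/
abbrev ChainField : Type := Derivation ℂ ChainPoly ChainPoly

noncomputable section

/- The general facts on Lie modules do not unify with the bracket of `ChainField`, so the ones
needed are stated for it directly. -/
namespace ChainField

variable (D E F : ChainField) (c : ℂ)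

theorem leibniz_lie : ⁅D, ⁅E, F⁆⁆ = ⁅⁅D, E⁆, F⁆ + ⁅E, ⁅D, F⁆⁆ :=
  Derivation.ext fun P => by
    simp only [Derivation.commutator_apply, Derivation.add_apply, map_sub]
    abel

theorem lie_swap : ⁅D, E⁆ = -⁅E, D⁆ :=
  Derivation.ext fun P => by simp only [Derivation.commutator_apply, Derivation.neg_apply, neg_sub]

@[simp] theorem lie_self : ⁅D, D⁆ = 0 :=
  Derivation.ext fun P => by simp

@[simp] theorem lie_zero : ⁅D, (0 : ChainField)⁆ = 0 :=
  Derivation.ext fun P => by simp [Derivation.commutator_apply]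

@[simp] theorem zero_lie : ⁅(0 : ChainField), D⁆ = 0 :=
  Derivation.ext fun P => by simp [Derivation.commutator_apply]

theorem add_lie : ⁅D + E, F⁆ = ⁅D, F⁆ + ⁅E, F⁆ :=
  Derivation.ext fun P => by
    simp only [Derivation.commutator_apply, Derivation.add_apply, map_add]
    abel

theorem lie_add : ⁅D, E + F⁆ = ⁅D, E⁆ + ⁅D, F⁆ :=
  Derivation.ext fun P => by
    simp only [Derivation.commutator_apply, Derivation.add_apply, map_add]
    abel

theorem sub_lie : ⁅D - E, F⁆ = ⁅D, F⁆ - ⁅E, F⁆ :=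
  Derivation.ext fun P => by
    simp only [Derivation.commutator_apply, Derivation.sub_apply, map_sub]
    abel

theorem neg_lie : ⁅-D, E⁆ = -⁅D, E⁆ :=
  Derivation.ext fun P => by
    simp only [Derivation.commutator_apply, Derivation.neg_apply, map_neg]
    abel

theorem smul_lie : ⁅c • D, E⁆ = c • ⁅D, E⁆ :=
  Derivation.ext fun P => by
    simp only [Derivation.commutator_apply, Derivation.smul_apply, Derivation.map_smul, smul_sub]

theorem lie_smul : ⁅D, c • E⁆ = c • ⁅D, E⁆ :=
  Derivation.ext fun P => by
    simp only [Derivation.commutator_apply, Derivation.smul_apply, Derivation.map_smul, smul_sub]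

end ChainField

/-- The shift `X m ↦ X (m + 1)`. -/
def chainShift : ChainPoly →ₐ[ℂ] ChainPoly := rename (· + 1)

@[simp] theorem chainShift_X (m : ℤ) : chainShift (X m) = X (m + 1) := by simp [chainShift]

theorem chainShift_injective : Function.Injective chainShift :=
  rename_injective _ (add_left_injective 1)

theorem pderiv_chainShift (m : ℤ) (P : ChainPoly) :
    pderiv (m + 1) (chainShift P) = chainShift (pderiv m P) :=
  pderiv_rename (add_left_injective (1 : ℤ)) m P

/-- A shift-invariant polynomial is constant, as it has no largest variable. -/
theorem exists_eq_C_of_chainShift_eq {P : ChainPoly} (h : chainShift P = P) : ∃ c, P = C c := by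
  rcases P.vars.eq_empty_or_nonempty with he | hne
  · exact ⟨_, vars_eq_empty_iff_eq_C.1 he⟩
  · exfalso
    have hmax := P.vars.max'_mem hne
    set M := P.vars.max' hne
    have h1 : pderiv (M + 1) P = 0 := pderiv_eq_zero_of_notMem_vars fun hm => by
      have := P.vars.le_max' _ hm
      omega
    have h2 : pderiv M P = 0 := chainShift_injective (by
      rw [← pderiv_chainShift, h, h1, map_zero])
    exact notMem_vars_of_pderiv_eq_zero h2 hmax

/-- The field `D` has order at most `k`: the velocity of `X m` involves only the variables `X j`
with `|j - m| ≤ k`. -/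
def IsLocal (D : ChainField) (k : ℕ) : Prop :=
  ∀ m : ℤ, (D (X m)).vars ⊆ Finset.Icc (m - k) (m + k)

theorem IsLocal.vars_apply {D : ChainField} {k : ℕ} (hD : IsLocal D k) {P : ChainPoly} {a b : ℤ}
    (hP : P.vars ⊆ Finset.Icc a b) : (D P).vars ⊆ Finset.Icc (a - k) (b + k) := by
  classical
  intro j hj
  by_contra hn
  refine absurd hj (notMem_vars_of_pderiv_eq_zero ?_)
  rw [derivation_apply_eq_sum D P _ (le_refl _), map_sum]
  refine Finset.sum_eq_zero fun i hi => ?_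
  have hi' := Finset.mem_Icc.1 (hP hi)
  rw [Finset.mem_Icc] at hn
  have h1 : pderiv j (D (X i)) = 0 := pderiv_eq_zero_of_notMem_vars fun h => by
    have := Finset.mem_Icc.1 (hD i h)
    omega
  have h2 : pderiv j P = 0 := pderiv_eq_zero_of_notMem_vars fun h => by
    have := Finset.mem_Icc.1 (hP h)
    omega
  rw [pderiv_mul, h1, pderiv_comm, h2, map_zero, zero_mul, mul_zero, add_zero]

theorem IsLocal.lie {D₁ D₂ : ChainField} {p q : ℕ} (h₁ : IsLocal D₁ p) (h₂ : IsLocal D₂ q) :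
    IsLocal ⁅D₁, D₂⁆ (p + q) := by
  classical
  intro m
  rw [Derivation.commutator_apply]
  refine (vars_sub_subset _).trans (Finset.union_subset ?_ ?_)
  · refine (h₁.vars_apply (h₂ m)).trans (Finset.Icc_subset_Icc ?_ ?_) <;> push_cast <;> omega
  · refine (h₂.vars_apply (h₁ m)).trans (Finset.Icc_subset_Icc ?_ ?_) <;> push_cast <;> omega

theorem IsLocal.mono {D : ChainField} {p q : ℕ} (h : IsLocal D p) (hpq : p ≤ q) : IsLocal D q :=
  fun m => (h m).trans (Finset.Icc_subset_Icc (by omega) (by omega))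

theorem IsLocal.pderiv_eq_zero {D : ChainField} {k : ℕ} (h : IsLocal D k) {m j : ℤ}
    (hj : j < m - k ∨ m + k < j) : pderiv j (D (X m)) = 0 :=
  pderiv_eq_zero_of_notMem_vars fun hm => by
    have := Finset.mem_Icc.1 (h m hm)
    omega

theorem IsLocal.sub {D₁ D₂ : ChainField} {k : ℕ} (h₁ : IsLocal D₁ k) (h₂ : IsLocal D₂ k) :
    IsLocal (D₁ - D₂) k := by
  classical
  exact fun m => (vars_sub_subset _).trans (Finset.union_subset (h₁ m) (h₂ m))

theorem IsLocal.smul {D : ChainField} {k : ℕ} (c : ℂ) (h : IsLocal D k) : IsLocal (c • D) k := by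
  intro m j hj
  by_contra hn
  refine absurd hj (notMem_vars_of_pderiv_eq_zero ?_)
  rw [Derivation.smul_apply, Derivation.map_smul,
    pderiv_eq_zero_of_notMem_vars (fun hm => hn (h m hm)),
    smul_zero]

/-- The coefficient of the rightmost variable that the bracket of two local fields can involve. -/
theorem pderiv_lie_top {D₁ D₂ : ChainField} {p q : ℕ} (hp : 0 < p) (hq : 0 < q)
    (h₁ : IsLocal D₁ p) (h₂ : IsLocal D₂ q) (m : ℤ) :
    pderiv (m + p + q) (⁅D₁, D₂⁆ (X m)) =
      pderiv (m + p + q) (D₁ (X (m + q))) * pderiv (m + q) (D₂ (X m)) -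
        pderiv (m + p + q) (D₂ (X (m + p))) * pderiv (m + p) (D₁ (X m)) := by
  rw [Derivation.commutator_apply, map_sub]
  congr 1
  · refine pderiv_derivation_of_unique D₁ _ _ _ (h₂.pderiv_eq_zero (by omega)) fun j hj hne => ?_
    have := Finset.mem_Icc.1 (h₂ m hj)
    exact h₁.pderiv_eq_zero (by omega)
  · refine pderiv_derivation_of_unique D₂ _ _ _ (h₁.pderiv_eq_zero (by omega)) fun j hj hne => ?_
    have := Finset.mem_Icc.1 (h₁ m hj)
    exact h₂.pderiv_eq_zero (by omega)

/-- The coefficient of the leftmost variable that the bracket of two local fields can involve. -/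
theorem pderiv_lie_bottom {D₁ D₂ : ChainField} {p q : ℕ} (hp : 0 < p) (hq : 0 < q)
    (h₁ : IsLocal D₁ p) (h₂ : IsLocal D₂ q) (m : ℤ) :
    pderiv (m - p - q) (⁅D₁, D₂⁆ (X m)) =
      pderiv (m - p - q) (D₁ (X (m - q))) * pderiv (m - q) (D₂ (X m)) -
        pderiv (m - p - q) (D₂ (X (m - p))) * pderiv (m - p) (D₁ (X m)) := by
  rw [Derivation.commutator_apply, map_sub]
  congr 1
  · refine pderiv_derivation_of_unique D₁ _ _ _ (h₂.pderiv_eq_zero (by omega)) fun j hj hne => ?_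
    have := Finset.mem_Icc.1 (h₂ m hj)
    exact h₁.pderiv_eq_zero (by omega)
  · refine pderiv_derivation_of_unique D₂ _ _ _ (h₁.pderiv_eq_zero (by omega)) fun j hj hne => ?_
    have := Finset.mem_Icc.1 (h₁ m hj)
    exact h₂.pderiv_eq_zero (by omega)

/-- A shift-invariant field is determined by the velocity of `X 0`. -/
theorem eq_zero_of_intertwines_chainShift {D : ChainField} (hT : Intertwines chainShift D D)
    (h : D (X 0) = 0) : D = 0 := by
  refine derivation_ext fun m => ?_
  rw [Derivation.zero_apply]
  induction m using Int.induction_on with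
  | zero => exact h
  | succ i ih => rw [← chainShift_X, hT, ih, map_zero]
  | pred i ih =>
    refine chainShift_injective ?_
    rw [← hT, chainShift_X, map_zero, sub_add_cancel, ih]

/-- The Euler vector field `X m ↦ X m`, whose eigenvectors are the homogeneous polynomials. -/
def eulerField : ChainField := mkDerivation ℂ X

@[simp] theorem eulerField_X (m : ℤ) : eulerField (X m) = X m := mkDerivation_X _ _ _

theorem coeff_eulerField (P : ChainPoly) (d : ℤ →₀ ℕ) :
    coeff d (eulerField P) = (d.degree : ℂ) * coeff d P := by
  classical
  induction P using MvPolynomial.induction_on' with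
  | monomial s a =>
    have : eulerField (monomial s a) = monomial s ((s.degree : ℂ) * a) := by
      have h : ∀ i ∈ s.support, monomial (s - Finsupp.single i 1) (s i : ℂ) • (X i : ChainPoly) =
          C (s i : ℂ) * monomial s 1 := fun i hi => by
        have hle : Finsupp.single i 1 ≤ s := by
          rw [Finsupp.single_le_iff]
          exact Nat.one_le_iff_ne_zero.2 (Finsupp.mem_support_iff.1 hi)
        rw [smul_eq_mul, X, monomial_mul, tsub_add_cancel_of_le hle, C_mul_monomial]
      rw [eulerField, mkDerivation_monomial, Finsupp.sum, Finset.sum_congr rfl h,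
        ← Finset.sum_mul, ← map_sum, C_mul_monomial, smul_monomial, Finsupp.degree_apply]
      push_cast
      simp [mul_comm]
    rw [this, coeff_monomial, coeff_monomial]
    split_ifs with h
    · rw [h]
    · simp
  | add p q hp hq => rw [map_add, coeff_add, coeff_add, hp, hq, mul_add]

theorem isHomogeneous_of_eulerField {P : ChainPoly} {n : ℕ} (h : eulerField P = (n : ℂ) • P) :
    P.IsHomogeneous n := by
  intro d hd
  have h1 := congrArg (coeff d) h
  rw [coeff_eulerField, coeff_smul, smul_eq_mul] at h1
  have h2 : d.degree = n := by exact_mod_cast mul_right_cancel₀ hd h1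
  exact (DFunLike.congr_fun Finsupp.degree_eq_weight_one d).symm.trans h2

theorem eulerField_pderiv {P : ChainPoly} {c : ℂ} (h : eulerField P = (c + 1) • P) (m : ℤ) :
    eulerField (pderiv m P) = c • pderiv m P := by
  have h1 : ⁅eulerField, (pderiv m : ChainField)⁆ = -(pderiv m : ChainField) := by
    refine derivation_ext fun l => ?_
    rw [Derivation.commutator_apply, eulerField_X, Derivation.neg_apply, pderiv_X, Pi.single_apply]
    split_ifs <;> simp
  have h2 := congrArg (fun D : ChainField => D P) h1
  simp only [Derivation.commutator_apply, Derivation.neg_apply, h, Derivation.map_smul] at h2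
  rw [sub_eq_iff_eq_add.1 h2]
  module

theorem eval_mul_of_isHomogeneous {P : ChainPoly} {n : ℕ} (h : P.IsHomogeneous n) (b : ℂ)
    (x : ℤ → ℂ) : eval (fun m => b * x m) P = b ^ n * eval x P := by
  rw [eval_eq, eval_eq, Finset.mul_sum]
  refine Finset.sum_congr rfl fun d hd => ?_
  have h1 := h.degree_eq_sum_deg_support hd
  simp_rw [mul_pow]
  rw [Finset.prod_mul_distrib, Finset.prod_pow_eq_pow_sum]
  rw [show ∑ i ∈ d.support, d i = n from h1.symm]
  ring

/-! ### The Volterra hierarchy -/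

/-- The Volterra equation `∂_t w_m = w_m (w_{m+1} - w_{m-1})`. -/
def volterraField : ChainField := mkDerivation ℂ fun m => X m * (X (m + 1) - X (m - 1))

/-- The master symmetry `w_m ((m + 2) w_{m+1} + w_m - (m - 1) w_{m-1})` of the Volterra
equation. -/
def volterraMaster : ChainField := mkDerivation ℂ fun m =>
  X m * (C ((m : ℂ) + 2) * X (m + 1) + X m - C ((m : ℂ) - 1) * X (m - 1))

/-- The Volterra hierarchy; `volterraFlow k` is its member of order `k + 1`. -/
def volterraFlow : ℕ → ChainField
  | 0 => volterraField
  | k + 1 => ⁅volterraMaster, volterraFlow k⁆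

theorem volterraField_X (m : ℤ) : volterraField (X m) = X m * (X (m + 1) - X (m - 1)) :=
  mkDerivation_X _ _ _

theorem volterraMaster_X (m : ℤ) : volterraMaster (X m) =
    X m * (C ((m : ℂ) + 2) * X (m + 1) + X m - C ((m : ℂ) - 1) * X (m - 1)) :=
  mkDerivation_X _ _ _

theorem isLocal_volterraField : IsLocal volterraField 1 := by
  classical
  intro m j hj
  by_contra hn
  rw [Finset.mem_Icc] at hn
  refine absurd hj (notMem_vars_of_pderiv_eq_zero ?_)
  rw [volterraField_X, pderiv_mul, map_sub, pderiv_X_of_ne, pderiv_X_of_ne, pderiv_X_of_ne]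
  · simp
  all_goals push_cast at hn; omega

theorem isLocal_volterraMaster : IsLocal volterraMaster 1 := by
  classical
  intro m j hj
  by_contra hn
  rw [Finset.mem_Icc] at hn
  refine absurd hj (notMem_vars_of_pderiv_eq_zero ?_)
  rw [volterraMaster_X, pderiv_mul, (pderiv j).map_sub, (pderiv j).map_add, pderiv_C_mul,
    pderiv_C_mul,
    pderiv_X_of_ne, pderiv_X_of_ne, pderiv_X_of_ne]
  · simp
  all_goals push_cast at hn; omega

theorem isLocal_volterraFlow (k : ℕ) : IsLocal (volterraFlow k) (k + 1) := by
  induction k with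
  | zero => exact isLocal_volterraField
  | succ k ih => exact (isLocal_volterraMaster.lie ih).mono (by omega)

/-- `volterraFlow k` is homogeneous: it raises the degree by `k + 1`. -/
theorem euler_lie_volterraFlow (k : ℕ) :
    ⁅eulerField, volterraFlow k⁆ = ((k : ℂ) + 1) • volterraFlow k := by
  induction k with
  | zero =>
    refine derivation_ext fun m => ?_
    simp only [volterraFlow, Derivation.commutator_apply, Derivation.smul_apply, volterraField_X,
      eulerField_X, Derivation.leibniz, map_sub, smul_eq_mul]
    simp only [Nat.cast_zero, zero_add, one_smul]
    ring
  | succ k ih =>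
    have h : ⁅eulerField, volterraMaster⁆ = volterraMaster := by
      refine derivation_ext fun m => ?_
      simp only [Derivation.commutator_apply, volterraMaster_X, eulerField_X, Derivation.leibniz,
        map_sub, map_add, smul_eq_mul, derivation_C]
      ring
    rw [volterraFlow, ChainField.leibniz_lie, h, ih, ChainField.lie_smul]
    push_cast
    module

theorem intertwines_shift_volterraField :
    Intertwines chainShift volterraField volterraField := .of_X fun m => by
  simp only [chainShift_X, volterraField_X, map_mul, map_sub]
  ring_nf

/-- The master symmetry depends explicitly on the position: the shift changes it by the Volterra
field. -/
theorem intertwines_shift_volterraMaster :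
    Intertwines chainShift (volterraMaster - volterraField) volterraMaster := .of_X fun m => by
  simp only [chainShift_X, volterraField_X, volterraMaster_X, map_mul, map_sub, map_add,
    Derivation.sub_apply, algHom_C, algebraMap_eq]
  rw [show m + 1 - 1 = m by ring, show m - 1 + 1 = m by ring]
  push_cast
  simp only [C_add, C_1, map_ofNat]
  ring

/-- The second Volterra flow, needed explicitly to start the induction on commutation. -/
theorem volterraFlow_one_X (m : ℤ) : volterraFlow 1 (X m) =
    X m * (X (m + 1) * (X (m + 2) + X (m + 1) + X m)
      - X (m - 1) * (X m + X (m - 1) + X (m - 2))) := by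
  simp only [volterraFlow, Derivation.commutator_apply, volterraField_X, volterraMaster_X,
    Derivation.leibniz, map_sub, map_add, smul_eq_mul, derivation_C]
  rw [show m + 1 - 1 = m by ring, show m - 1 + 1 = m by ring, show m + 1 + 1 = m + 2 by ring,
    show m - 1 - 1 = m - 2 by ring]
  push_cast
  simp only [C_add, C_sub, C_1, map_ofNat]
  ring

theorem volterraField_lie_volterraFlow_one : ⁅volterraField, volterraFlow 1⁆ = 0 := by
  refine derivation_ext fun m => ?_
  simp only [Derivation.commutator_apply, volterraField_X, volterraFlow_one_X,
    Derivation.leibniz, map_sub, map_add, smul_eq_mul, Derivation.zero_apply]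
  rw [show m + 1 - 1 = m by ring, show m - 1 + 1 = m by ring, show m + 1 + 1 = m + 2 by ring,
    show m - 1 - 1 = m - 2 by ring, show m + 2 - 1 = m + 1 by ring, show m - 2 + 1 = m - 1 by ring,
    show m + 2 + 1 = m + 3 by ring, show m - 2 - 1 = m - 3 by ring,
    show m + 1 + 2 = m + 3 by ring, show m + 1 - 2 = m - 1 by ring,
    show m - 1 + 2 = m + 1 by ring, show m - 1 - 2 = m - 3 by ring]
  ring

/-! ### The centralizer of the Volterra equation -/

theorem volterraField_apply_of_lie_eq_zero {D : ChainField} (hK : ⁅volterraField, D⁆ = 0)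
    (hT : Intertwines chainShift D D) :
    volterraField (D (X 0)) =
      D (X 0) * (X 1 - X (-1)) + X 0 * (chainShift (D (X 0)) - D (X (-1))) := by
  have h := congrArg (fun D : ChainField => D (X 0)) hK
  simp only [Derivation.commutator_apply, Derivation.zero_apply, sub_eq_zero] at h
  rw [h, volterraField_X, ← hT, chainShift_X]
  simp only [Derivation.leibniz, smul_eq_mul, map_sub, zero_add, zero_sub]
  ring

theorem pderiv_apply_X_neg_one {D : ChainField} (hT : Intertwines chainShift D D) {r : ℕ}
    (hD : ∀ j : ℤ, r < j → pderiv j (D (X 0)) = 0) : pderiv ((r : ℤ) + 1) (D (X (-1))) = 0 :=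
  chainShift_injective (by
    rw [← pderiv_chainShift, ← hT, chainShift_X, neg_add_cancel, map_zero]
    exact hD _ (by omega))

theorem pderiv_volterraField {P : ChainPoly} {r : ℕ} (hP : ∀ j : ℤ, r < j → pderiv j P = 0) :
    pderiv ((r : ℤ) + 1) (volterraField P) = X (r : ℤ) * pderiv (r : ℤ) P := by
  rw [pderiv_derivation_of_unique volterraField _ (r : ℤ) _ (hP _ (by omega)), volterraField_X,
    pderiv_mul, map_sub, pderiv_X_self, pderiv_X_of_ne (by omega), pderiv_X_of_ne (by omega)]
  · ring
  · intro j hj hne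
    have : j ≤ r := by
      by_contra hlt
      exact notMem_vars_of_pderiv_eq_zero (hP j (by omega)) hj
    exact isLocal_volterraField.pderiv_eq_zero (by push_cast; omega)

/-- The top coefficient `a` of a shift-invariant field commuting with the Volterra equation
satisfies `T(a) X_0 = a X_r`, `T` the shift. -/
theorem chainShift_pderiv_mul_X {D : ChainField} (hK : ⁅volterraField, D⁆ = 0)
    (hT : Intertwines chainShift D D) {r : ℕ} (hr : 0 < r)
    (hD : ∀ j : ℤ, r < j → pderiv j (D (X 0)) = 0) :
    chainShift (pderiv (r : ℤ) (D (X 0))) * X 0 = pderiv (r : ℤ) (D (X 0)) * X (r : ℤ) := by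
  have h := congrArg (pderiv ((r : ℤ) + 1)) (volterraField_apply_of_lie_eq_zero hK hT)
  rw [pderiv_volterraField hD, map_add, pderiv_mul, pderiv_mul, map_sub, map_sub,
    pderiv_chainShift, pderiv_apply_X_neg_one hT hD, hD _ (show (r : ℤ) < r + 1 by omega),
    pderiv_X_of_ne (by omega), pderiv_X_of_ne (by omega), pderiv_X_of_ne (by omega)] at h
  linear_combination -h

/-- A shift-invariant field commuting with the Volterra equation depends on some variable to the
right of the centre, unless it is zero. -/
theorem apply_X_zero_eq_zero_of_lie_eq_zero {D : ChainField} (hK : ⁅volterraField, D⁆ = 0)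
    (hT : Intertwines chainShift D D) (hD : ∀ j : ℤ, 0 < j → pderiv j (D (X 0)) = 0) :
    D (X 0) = 0 := by
  have hD' : ∀ j : ℤ, ((0 : ℕ) : ℤ) < j → pderiv j (D (X 0)) = 0 := by simpa using hD
  have h := congrArg (pderiv (((0 : ℕ) : ℤ) + 1)) (volterraField_apply_of_lie_eq_zero hK hT)
  rw [pderiv_volterraField hD', map_add, pderiv_mul, pderiv_mul, map_sub, map_sub,
    pderiv_chainShift, pderiv_apply_X_neg_one hT hD', Nat.cast_zero, hD (0 + 1) (by omega),
    pderiv_X_of_ne (show (0 : ℤ) ≠ 0 + 1 by omega),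
    pderiv_X_of_ne (show (-1 : ℤ) ≠ 0 + 1 by omega)] at h
  rw [zero_add, pderiv_X_self] at h
  set Q := D (X 0) with hQ
  set a := pderiv (0 : ℤ) Q with ha
  have h0 : X 0 * a = Q + X 0 * chainShift a := by linear_combination h
  have h1 : pderiv (0 : ℤ) a = 0 := by
    refine chainShift_injective (mul_left_cancel₀ (X_ne_zero (0 : ℤ)) ?_)
    -- Of the terms of `h0`, only `X 0 * chainShift a` can involve `X 1`.
    have h2 := congrArg (pderiv ((0 : ℤ) + 1)) h0
    rw [map_add, pderiv_mul, pderiv_mul, pderiv_chainShift, pderiv_X_of_ne (by omega), zero_add,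
      hD 1 one_pos, ha, pderiv_comm, hD 1 one_pos, map_zero, ← ha] at h2
    rw [map_zero]
    linear_combination -h2
  have h2 : chainShift a = 0 := by
    refine eq_zero_of_pderiv_X_mul_eq_zero (i := (0 : ℤ)) ?_
    have h2 := congrArg (pderiv (0 : ℤ)) h0
    rw [map_add, pderiv_mul, h1, pderiv_X_self, ← ha] at h2
    linear_combination -h2
  have h3 : a = 0 := chainShift_injective (by rw [h2, map_zero])
  rw [h2, h3] at h0
  linear_combination -h0

/-- A solution of `T(a) X_i = a X_{i+n}`, `T` the shift, is a multiple of
`X_i ⋯ X_{i+n-1}`; so it is zero if it is homogeneous of another degree. -/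
theorem eq_zero_of_chainShift_mul_X (n : ℕ) : ∀ (i : ℤ) (e : ℕ) (a : ChainPoly), n < e →
    eulerField a = (e : ℂ) • a → chainShift a * X i = a * X (i + n) → a = 0 := by
  induction n with
  | zero =>
    intro i e a he hE h
    obtain ⟨c, rfl⟩ := exists_eq_C_of_chainShift_eq
      (mul_right_cancel₀ (X_ne_zero i) (by simpa using h))
    rw [derivation_C] at hE
    exact (smul_eq_zero.1 hE.symm).resolve_left (by exact_mod_cast he.ne')
  | succ n ih =>
    intro i e a he hE h
    have hdvd : (X i : ChainPoly) ∣ a := by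
      refine (X_dvd_mul_iff.1 (Dvd.intro_left _ h)).resolve_right fun h' => ?_
      have := X_dvd_X.1 h'
      push_cast at this
      omega
    obtain ⟨b, rfl⟩ := hdvd
    obtain ⟨e, rfl⟩ : ∃ e', e = e' + 1 := ⟨e - 1, by omega⟩
    have hb : b = 0 := by
      refine ih (i + 1) e b (by omega) ?_ ?_
      · refine mul_left_cancel₀ (X_ne_zero i) ?_
        rw [Derivation.leibniz, eulerField_X] at hE
        simp only [smul_eq_C_mul, smul_eq_mul] at hE ⊢
        push_cast at hE
        rw [C_add, C_1] at hE
        linear_combination hE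
      · refine mul_left_cancel₀ (X_ne_zero i) ?_
        rw [map_mul, chainShift_X] at h
        push_cast at h
        rw [show i + 1 + (n : ℤ) = i + (n + 1) by ring]
        linear_combination h
    rw [hb, mul_zero]

/-- A nonzero shift-invariant homogeneous field of order `r` that commutes with the Volterra
equation raises the degree by `r`, since its top coefficient is a multiple of
`X_0 ⋯ X_{r-1}`; so one that raises it by `e + 1 > r` is zero. -/
theorem eq_zero_of_volterraField_lie {D : ChainField} (hK : ⁅volterraField, D⁆ = 0)
    (hT : Intertwines chainShift D D) {e : ℕ} (hE : ⁅eulerField, D⁆ = ((e : ℂ) + 1) • D)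
    (r : ℕ) (hr : r ≤ e) (hD : ∀ j : ℤ, r < j → pderiv j (D (X 0)) = 0) : D = 0 := by
  refine eq_zero_of_intertwines_chainShift hT ?_
  have hQ : eulerField (D (X 0)) = (((e + 1 : ℕ) : ℂ) + 1) • D (X 0) := by
    have h := congrArg (fun D : ChainField => D (X 0)) hE
    simp only [Derivation.commutator_apply, Derivation.smul_apply, eulerField_X] at h
    rw [sub_eq_iff_eq_add.1 h]
    push_cast
    module
  induction r with
  | succ r ih =>
    refine ih (by omega) fun j hj => ?_
    rcases eq_or_ne j ((r + 1 : ℕ) : ℤ) with rfl | hne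
    · refine eq_zero_of_chainShift_mul_X (r + 1) 0 (e + 1) _ (by omega)
        (eulerField_pderiv hQ _) ?_
      rw [zero_add]
      exact chainShift_pderiv_mul_X hK hT (by omega) hD
    · exact hD j (by push_cast at hne ⊢; omega)
  | zero => exact apply_X_zero_eq_zero_of_lie_eq_zero hK hT (by simpa using hD)

/-- The flows `V_k`, short for `volterraFlow k`, are shift-invariant and commute with
`K = V_0`. The two properties are proved together: `K` measures the failure of the master symmetry
to be shift-invariant. By the Jacobi identity `[K, V_{k+1}] = -[V_1, V_k]`; this bracket commutes
with `K`, raises the degree by `k + 3`, and has order below `k + 3` because its top coefficient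
cancels. For `k = 0` the identity is vacuous, and `[K, V_1] = 0` is a computation. -/
theorem volterraField_lie_volterraFlow (k : ℕ) :
    Intertwines chainShift (volterraFlow k) (volterraFlow k) ∧
      ⁅volterraField, volterraFlow k⁆ = 0 := by
  induction k with
  | zero => exact ⟨intertwines_shift_volterraField, ChainField.lie_self _⟩
  | succ k ih =>
    have hshift : ∀ l, Intertwines chainShift (volterraFlow l) (volterraFlow l) →
        ⁅volterraField, volterraFlow l⁆ = 0 →
        Intertwines chainShift (volterraFlow (l + 1)) (volterraFlow (l + 1)) := by
      intro l h1 h2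
      have h := intertwines_shift_volterraMaster.lie h1
      rwa [ChainField.sub_lie, h2, sub_zero] at h
    refine ⟨hshift k ih.1 ih.2, ?_⟩
    rcases Nat.eq_zero_or_pos k with rfl | hk
    · exact volterraField_lie_volterraFlow_one
    have hT1 : Intertwines chainShift (volterraFlow 1) (volterraFlow 1) :=
      hshift 0 intertwines_shift_volterraField (ChainField.lie_self _)
    have hK1 := volterraField_lie_volterraFlow_one
    have hTk := ih.1
    have hKk := ih.2
    have hlie : ⁅volterraFlow 1, volterraFlow k⁆ = 0 := by
      have hK : ⁅volterraField, ⁅volterraFlow 1, volterraFlow k⁆⁆ = 0 := by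
        rw [ChainField.leibniz_lie, hK1, hKk, ChainField.zero_lie, ChainField.lie_zero, add_zero]
      have hE : ⁅eulerField, ⁅volterraFlow 1, volterraFlow k⁆⁆ =
          (((k + 2 : ℕ) : ℂ) + 1) • ⁅volterraFlow 1, volterraFlow k⁆ := by
        rw [ChainField.leibniz_lie, euler_lie_volterraFlow, euler_lie_volterraFlow,
          ChainField.smul_lie, ChainField.lie_smul]
        push_cast
        module
      have h1 := isLocal_volterraFlow 1
      have h2 := isLocal_volterraFlow k
      refine eq_zero_of_volterraField_lie hK (hT1.lie hTk) hE (k + 2) le_rfl fun j hj => ?_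
      rcases (show (k : ℤ) + 3 ≤ j by push_cast at hj; omega).lt_or_eq with hlt | rfl
      · exact (h1.lie h2).pderiv_eq_zero (by push_cast; omega)
      have htop := pderiv_lie_top (by omega) (by omega) h1 h2 0
      have ht := chainShift_pderiv_mul_X hKk hTk (r := k + 1) (by omega)
        fun j hj => h2.pderiv_eq_zero (by push_cast at hj ⊢; omega)
      have ht' := congrArg chainShift ht
      have hV1 : ∀ m : ℤ, pderiv (m + 2) (volterraFlow 1 (X m)) = X m * X (m + 1) := fun m => by
        rw [volterraFlow_one_X, pderiv_mul, map_sub, pderiv_mul, pderiv_mul, map_add, map_add,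
          map_add, map_add, pderiv_X_self, pderiv_X_of_ne (by omega), pderiv_X_of_ne (by omega),
          pderiv_X_of_ne (by omega), pderiv_X_of_ne (by omega)]
        ring
      have hVk : pderiv ((k : ℤ) + 3) (volterraFlow k (X 2)) =
          chainShift (chainShift (pderiv ((k : ℤ) + 1) (volterraFlow k (X 0)))) := by
        rw [← pderiv_chainShift, ← pderiv_chainShift, ← hTk, ← hTk, chainShift_X, chainShift_X]
        ring_nf
      have hV1k := hV1 ((k : ℤ) + 1)
      have hV10 := hV1 0
      push_cast at htop ht ht'
      rw [show (k : ℤ) + 1 + 2 = k + 3 by ring, show (k : ℤ) + 1 + 1 = k + 2 by ring] at hV1k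
      rw [show (2 : ℤ) + (k + 1) = k + 3 by ring, zero_add, hV1k, hVk] at htop
      rw [zero_add, zero_add] at hV10
      rw [hV10] at htop
      simp only [map_mul, chainShift_X, zero_add] at ht'
      rw [show (k : ℤ) + 1 + 1 = k + 2 by ring] at ht'
      rw [htop]
      linear_combination (-X 0) * ht' - X ((k : ℤ) + 2) * ht
    have := ChainField.leibniz_lie volterraField volterraMaster (volterraFlow k)
    have h2 : ⁅volterraField, volterraMaster⁆ = -volterraFlow 1 := by
      rw [ChainField.lie_swap, volterraFlow, volterraFlow]
    rw [volterraFlow, this, h2, hKk, ChainField.neg_lie, hlie, ChainField.lie_zero, neg_zero,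
      add_zero]

/-! ### The modified Volterra hierarchy and its Miura transformations -/

/-- The modified Volterra equation `∂_t u_m = (u_m² - 1) (u_{m+1} - u_{m-1})`. -/
def mvField : ChainField := mkDerivation ℂ fun m => (X m ^ 2 - 1) * (X (m + 1) - X (m - 1))

/-- The master symmetry of the modified Volterra equation. -/
def mvMaster : ChainField := mkDerivation ℂ fun m =>
  (X m ^ 2 - 1) * (C ((m : ℂ) + 1) * X (m + 1) - C ((m : ℂ) - 1) * X (m - 1))

/-- The modified Volterra hierarchy generated by the master symmetry; `mvFlow k` is its member of
order `k + 1`. -/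
def mvFlow : ℕ → ChainField
  | 0 => mvField
  | k + 1 => ⁅mvMaster, mvFlow k⁆

/-- The modified Volterra hierarchy corrected by lower order members, so that a Miura
transformation sends `symFlow k` to `volterraFlow k`. -/
def symFlow : ℕ → ChainField
  | 0 => mvField
  | k + 1 => ⁅mvMaster, symFlow k⁆ - (4 * ((k : ℂ) + 1)) • symFlow k

/-- The Miura transformation `w_m = (u_{m+1} + ε) (u_m - ε)`. -/
def miura (ε : ℂ) : ChainPoly →ₐ[ℂ] ChainPoly :=
  aeval fun m => (X (m + 1) + C ε) * (X m - C ε)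

@[simp] theorem miura_X (ε : ℂ) (m : ℤ) : miura ε (X m) = (X (m + 1) + C ε) * (X m - C ε) := by
  simp [miura]

theorem mvField_X (m : ℤ) : mvField (X m) = (X m ^ 2 - 1) * (X (m + 1) - X (m - 1)) :=
  mkDerivation_X _ _ _

theorem mvMaster_X (m : ℤ) : mvMaster (X m) =
    (X m ^ 2 - 1) * (C ((m : ℂ) + 1) * X (m + 1) - C ((m : ℂ) - 1) * X (m - 1)) :=
  mkDerivation_X _ _ _

theorem intertwines_miura_mvField {ε : ℂ} (hε : ε ^ 2 = 1) :
    Intertwines (miura ε) mvField volterraField := .of_X fun m => by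
  simp only [miura_X, Derivation.leibniz, map_sub, map_add, map_mul, derivation_C, mvField_X,
    volterraField_X, smul_eq_mul]
  rw [show m + 1 - 1 = m by ring, show m - 1 + 1 = m by ring, show m + 1 + 1 = m + 2 by ring]
  rcases eq_or_eq_neg_of_sq_eq_sq ε 1 (by rw [hε, one_pow]) with rfl | rfl <;>
    simp only [C_neg, C_1] <;> ring

/-- The Miura transformation carries the master symmetry of the modified Volterra equation to that
of the Volterra equation, up to a scaling field. -/
theorem intertwines_miura_mvMaster {ε : ℂ} (hε : ε ^ 2 = 1) :
    Intertwines (miura ε) mvMaster (volterraMaster + (4 : ℂ) • eulerField) := .of_X fun m => by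
  simp only [miura_X, Derivation.leibniz, Derivation.add_apply, Derivation.smul_apply, map_sub,
    map_add, map_mul, derivation_C, mvMaster_X, volterraMaster_X, eulerField_X, smul_eq_mul,
    algHom_C, algebraMap_eq, smul_eq_C_mul]
  rw [show m + 1 - 1 = m by ring, show m - 1 + 1 = m by ring, show m + 1 + 1 = m + 2 by ring]
  push_cast
  rcases eq_or_eq_neg_of_sq_eq_sq ε 1 (by rw [hε, one_pow]) with rfl | rfl <;>
    simp only [C_add, C_neg, C_1, map_ofNat] <;> ring

/-- The correction term in `symFlow` cancels the bracket of the scaling field with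
`volterraFlow k`. -/
theorem intertwines_miura_symFlow {ε : ℂ} (hε : ε ^ 2 = 1) (k : ℕ) :
    Intertwines (miura ε) (symFlow k) (volterraFlow k) := by
  induction k with
  | zero => exact intertwines_miura_mvField hε
  | succ k ih =>
    have h := ((intertwines_miura_mvMaster hε).lie ih).sub (ih.smul (4 * ((k : ℂ) + 1)))
    rwa [ChainField.add_lie, ChainField.smul_lie, euler_lie_volterraFlow, smul_smul,
      add_sub_cancel_right] at h

/-- A field that annihilates both Miura transformations is zero: its values at `u_m` and `u_{m+1}`
solve a linear system with determinant `-2 (u_m + u_{m+1})`. -/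
theorem eq_zero_of_intertwines_miura {D : ChainField} (h₁ : Intertwines (miura 1) D 0)
    (h₂ : Intertwines (miura (-1)) D 0) : D = 0 := by
  refine derivation_ext fun m => ?_
  have e₁ := h₁ (X m)
  have e₂ := h₂ (X m)
  simp only [miura_X, Derivation.leibniz, map_sub, map_add, derivation_C, smul_eq_mul,
    Derivation.zero_apply, map_zero] at e₁ e₂
  simp only [C_neg, C_1] at e₁ e₂
  have h : (X m + X (m + 1) : ChainPoly) * D (X m) = 0 := by
    have h2 : (2 : ChainPoly) * ((X m + X (m + 1)) * D (X m)) = 0 := by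
      linear_combination (X m + 1) * e₁ - (X m - 1) * e₂
    exact (mul_eq_zero.1 h2).resolve_left two_ne_zero
  refine (mul_eq_zero.1 h).resolve_left fun h0 => ?_
  have := congrArg (eval fun _ => (1 : ℂ)) h0
  norm_num at this

/-- Commutation is inherited from the Volterra flows through the two Miura transformations. -/
theorem mvField_lie_symFlow (k : ℕ) : ⁅mvField, symFlow k⁆ = 0 := by
  have h : ∀ {ε : ℂ}, ε ^ 2 = 1 → Intertwines (miura ε) ⁅mvField, symFlow k⁆ 0 := fun hε => by
    have := (intertwines_miura_mvField hε).lie (intertwines_miura_symFlow hε k)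
    rwa [(volterraField_lie_volterraFlow k).2] at this
  exact eq_zero_of_intertwines_miura (h (by norm_num)) (h (by norm_num))

/-- The explicit dependence on the position in the master symmetry drops out of the symmetries. -/
theorem intertwines_shift_symFlow (k : ℕ) :
    Intertwines chainShift (symFlow k) (symFlow k) := by
  have h0 : Intertwines chainShift mvField mvField := .of_X fun m => by
    simp only [chainShift_X, mvField_X, map_mul, map_sub, map_pow, map_one]
    ring_nf
  have h1 : Intertwines chainShift (mvMaster - mvField) mvMaster := .of_X fun m => by
    simp only [chainShift_X, mvField_X, mvMaster_X, map_mul, map_sub, map_pow, map_one,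
      Derivation.sub_apply, algHom_C, algebraMap_eq, map_add]
    rw [show m + 1 - 1 = m by ring, show m - 1 + 1 = m by ring]
    push_cast
    simp only [C_add, C_1]
    ring
  induction k with
  | zero => exact h0
  | succ k ih =>
    have h := (h1.lie ih).sub (ih.smul (4 * ((k : ℂ) + 1)))
    rwa [ChainField.sub_lie, mvField_lie_symFlow, sub_zero] at h

theorem isLocal_mvField : IsLocal mvField 1 := by
  intro m j hj
  by_contra hn
  rw [Finset.mem_Icc] at hn
  refine absurd hj (notMem_vars_of_pderiv_eq_zero ?_)
  rw [mvField_X, pderiv_mul, (pderiv j).map_sub, (pderiv j).map_sub, pderiv_pow,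
    pderiv_X_of_ne, pderiv_X_of_ne, pderiv_X_of_ne]
  · simp
  all_goals push_cast at hn; omega

theorem isLocal_mvMaster : IsLocal mvMaster 1 := by
  intro m j hj
  by_contra hn
  rw [Finset.mem_Icc] at hn
  refine absurd hj (notMem_vars_of_pderiv_eq_zero ?_)
  rw [mvMaster_X, pderiv_mul, (pderiv j).map_sub, (pderiv j).map_sub, pderiv_pow,
    pderiv_C_mul, pderiv_C_mul, pderiv_X_of_ne, pderiv_X_of_ne, pderiv_X_of_ne]
  · simp
  all_goals push_cast at hn; omega

theorem isLocal_mvFlow (k : ℕ) : IsLocal (mvFlow k) (k + 1) := by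
  induction k with
  | zero => exact isLocal_mvField
  | succ k ih => exact (isLocal_mvMaster.lie ih).mono (by omega)

theorem isLocal_symFlow (k : ℕ) : IsLocal (symFlow k) (k + 1) := by
  induction k with
  | zero => exact isLocal_mvField
  | succ k ih =>
    exact ((isLocal_mvMaster.lie ih).mono (by omega)).sub ((ih.smul _).mono (by omega))

/-- At `u = 0` the top coefficient of `symFlow k` is `(-1)^(k+1) k!`. -/
theorem eval_pderiv_symFlow_top (k : ℕ) (m : ℤ) :
    eval (0 : ℤ → ℂ) (pderiv (m + (k + 1)) (symFlow k (X m))) =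
      (-1) ^ (k + 1) * (k.factorial : ℂ) := by
  induction k generalizing m with
  | zero =>
    simp [symFlow, mvField_X, pderiv_X_of_ne (show m - 1 ≠ m + 1 by omega),
      pderiv_X_of_ne (show m ≠ m + 1 by omega)]
  | succ k ih =>
    have h := pderiv_lie_top (by omega) (by omega) isLocal_mvMaster (isLocal_symFlow k) m
    have hg : ∀ l : ℤ, eval (0 : ℤ → ℂ) (pderiv (l + 1) (mvMaster (X l))) = -((l : ℂ) + 1) := by
      intro l
      rw [mvMaster_X, pderiv_mul, (pderiv _).map_sub, (pderiv _).map_sub, pderiv_pow, pderiv_C_mul,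
        pderiv_C_mul, pderiv_X_self, pderiv_X_of_ne (show l ≠ l + 1 by omega),
        pderiv_X_of_ne (show l - 1 ≠ l + 1 by omega)]
      simp
    have i1 := ih m
    have i2 := ih (m + 1)
    have g1 := hg m
    have g2 := hg (m + (k + 1))
    have h4 : pderiv (m + ((k : ℤ) + 2)) (symFlow k (X m)) = 0 :=
      (isLocal_symFlow k).pderiv_eq_zero (by push_cast; omega)
    push_cast at h g2 ⊢
    rw [show m + 1 + ((k : ℤ) + 1) = m + (k + 2) by ring] at h i2
    rw [show m + ((k : ℤ) + 1) + 1 = m + (k + 2) by ring] at g2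
    rw [show m + ((k : ℤ) + 1 + 1) = m + (k + 2) by ring, symFlow, Derivation.sub_apply,
      Derivation.smul_apply, map_sub, Derivation.map_smul, h4, smul_zero, sub_zero, h, map_sub,
      map_mul, map_mul, i1, i2, g1, g2, Nat.factorial_succ]
    push_cast
    ring

/-- At `u = 0` the bottom coefficient of `symFlow k` is `(-1)^k k!`. -/
theorem eval_pderiv_symFlow_bottom (k : ℕ) (m : ℤ) :
    eval (0 : ℤ → ℂ) (pderiv (m - (k + 1)) (symFlow k (X m))) =
      (-1) ^ k * (k.factorial : ℂ) := by
  induction k generalizing m with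
  | zero =>
    simp [symFlow, mvField_X, pderiv_X_of_ne (show m + 1 ≠ m - 1 by omega),
      pderiv_X_of_ne (show m ≠ m - 1 by omega)]
  | succ k ih =>
    have h := pderiv_lie_bottom (by omega) (by omega) isLocal_mvMaster (isLocal_symFlow k) m
    have hg : ∀ l : ℤ, eval (0 : ℤ → ℂ) (pderiv (l - 1) (mvMaster (X l))) = (l : ℂ) - 1 := by
      intro l
      rw [mvMaster_X, pderiv_mul, (pderiv _).map_sub, (pderiv _).map_sub, pderiv_pow, pderiv_C_mul,
        pderiv_C_mul, pderiv_X_self, pderiv_X_of_ne (show l ≠ l - 1 by omega),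
        pderiv_X_of_ne (show l + 1 ≠ l - 1 by omega)]
      simp
    have i1 := ih m
    have i2 := ih (m - 1)
    have g1 := hg m
    have g2 := hg (m - (k + 1))
    have h4 : pderiv (m - ((k : ℤ) + 2)) (symFlow k (X m)) = 0 :=
      (isLocal_symFlow k).pderiv_eq_zero (by push_cast; omega)
    push_cast at h g2 ⊢
    rw [show m - 1 - ((k : ℤ) + 1) = m - (k + 2) by ring] at h i2
    rw [show m - ((k : ℤ) + 1) - 1 = m - (k + 2) by ring] at g2
    rw [show m - ((k : ℤ) + 1 + 1) = m - (k + 2) by ring, symFlow, Derivation.sub_apply,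
      Derivation.smul_apply, map_sub, Derivation.map_smul, h4, smul_zero, sub_zero, h, map_sub,
      map_mul, map_mul, i1, i2, g1, g2, Nat.factorial_succ]
    push_cast
    ring

/-! ### The two-dimensional lattice -/

/-- The embedding `X m ↦ u_{n,m}` of the one-dimensional lattice as the `n`-th column. -/
def chainAt (n : ℤ) : ChainPoly →ₐ[ℂ] LatticePoly := rename fun m => (n, m)

@[simp] theorem chainAt_X (n m : ℤ) : chainAt n (X m) = latticeVar n m := by
  simp [chainAt, latticeVar]

theorem prodMk_injective (n : ℤ) : Function.Injective fun m : ℤ => (n, m) :=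
  fun _ _ h => (Prod.mk.inj h).2

theorem latticeDeriv_chainAt (n m : ℤ) (P : ChainPoly) :
    latticeDeriv n m (chainAt n P) = chainAt n (pderiv m P) :=
  pderiv_rename (prodMk_injective n) m P

theorem apply_apply_X_eq_sum (D : ChainField) {D' : ChainField} {k : ℕ} (h : IsLocal D' k)
    (m : ℤ) : D (D' (X m)) =
      ∑ j ∈ Finset.Icc (-(k : ℤ)) k, D (X (m + j)) * pderiv (m + j) (D' (X m)) := by
  rw [derivation_apply_eq_sum D _ _ (h m), sub_eq_add_neg, ← Finset.map_add_left_Icc,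
    Finset.sum_map]
  rfl

theorem masterSym_eq (n m : ℤ) : masterSym n m = chainAt n (mvMaster (X m)) := by
  simp only [masterSym, mvMaster_X, map_mul, map_sub, map_pow, map_one, chainAt_X, algHom_C,
    algebraMap_eq, map_add]

theorem mvHierarchy_eq (k : ℕ) (n m : ℤ) :
    mvHierarchy (k + 1) n m = chainAt n (mvFlow k (X m)) := by
  induction k generalizing m with
  | zero =>
    simp only [mvHierarchy, mVolterra, mvFlow, mvField_X, map_mul, map_sub, map_pow, map_one,
      chainAt_X]
  | succ k ih =>
    simp only [mvHierarchy, mvFlow, ih, masterSym_eq, latticeDeriv_chainAt]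
    rw [Derivation.commutator_apply, apply_apply_X_eq_sum _ (isLocal_mvFlow k),
      apply_apply_X_eq_sum _ isLocal_mvMaster]
    simp only [map_sub, map_sum, map_mul, Nat.cast_add, Nat.cast_one]

theorem symCoeff_eq_zero {k j : ℕ} (h : k ≤ j) : symCoeff k j = 0 := by
  induction k generalizing j with
  | zero => rfl
  | succ k ih =>
    obtain ⟨j, rfl⟩ : ∃ i, j = i + 1 := ⟨j - 1, by omega⟩
    cases k with
    | zero => rfl
    | succ k => rw [symCoeff, ih (by omega), ih (by omega), mul_zero, sub_zero]

/-- The recursion of the constants `c_{k,j}` is the one that turns the master symmetry `g` into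
`[g, ·] - 4k`. -/
theorem sum_symCoeff_smul_mvFlow (k : ℕ) :
    ∑ j ∈ Finset.range (k + 1), ((4 : ℂ) ^ j * (symCoeff (k + 1) j : ℂ)) • mvFlow (k - j) =
      symFlow k := by
  induction k with
  | zero => simp [symCoeff, mvFlow, symFlow]
  | succ k ih =>
    have hlie : ∀ (s : Finset ℕ) (c : ℕ → ℂ) (D : ℕ → ChainField),
        ⁅mvMaster, ∑ j ∈ s, c j • D j⁆ = ∑ j ∈ s, c j • ⁅mvMaster, D j⁆ := by
      intro s c D
      induction s using Finset.induction_on with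
      | empty => simp
      | insert i s hi ih =>
        rw [Finset.sum_insert hi, Finset.sum_insert hi, ChainField.lie_add, ChainField.lie_smul, ih]
    have h1 : ⁅mvMaster, symFlow k⁆ = ∑ j ∈ Finset.range (k + 2),
        ((4 : ℂ) ^ j * (symCoeff (k + 1) j : ℂ)) • mvFlow (k + 1 - j) := by
      rw [← ih, hlie, Finset.sum_range_succ _ (k + 1), symCoeff_eq_zero le_rfl, Int.cast_zero,
        mul_zero, zero_smul, add_zero]
      refine Finset.sum_congr rfl fun j hj => ?_
      rw [Nat.succ_sub (Nat.lt_succ_iff.1 (Finset.mem_range.1 hj)), mvFlow]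
    rw [symFlow, h1, ← ih, Finset.sum_range_succ' _ (k + 1), Finset.sum_range_succ' _ (k + 1),
      Finset.smul_sum, add_sub_right_comm, ← Finset.sum_sub_distrib]
    congr 1
    refine Finset.sum_congr rfl fun j _ => ?_
    rw [symCoeff, Nat.add_sub_add_right]
    push_cast
    module

theorem symRhs_succ (β : ℂ) (k : ℕ) (n m : ℤ) :
    symRhs β (k + 1) n m = C (β ^ (n * ((k + 1 : ℕ) : ℤ))) * chainAt n (symFlow k (X m)) := by
  rw [symRhs, ← sum_symCoeff_smul_mvFlow, derivation_sum_apply, map_sum]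
  congr 1
  refine Finset.sum_congr rfl fun j hj => ?_
  rw [Nat.succ_sub (Nat.lt_succ_iff.1 (Finset.mem_range.1 hj)), mvHierarchy_eq,
    Derivation.smul_apply, map_smul, smul_eq_C_mul]

theorem rename_add_eq_of_intertwines {D : ChainField} (hT : Intertwines chainShift D D) (m : ℤ) :
    rename (· + m) (D (X 0)) = D (X m) := by
  have hsucc : ∀ (i : ℤ) (P : ChainPoly),
      rename (· + (i + 1)) P = chainShift (rename (· + i) P) := fun i P => by
    rw [chainShift, rename_rename]
    congr 2
    funext x
    exact (add_assoc x i 1).symm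
  induction m using Int.induction_on with
  | zero =>
    simp only [add_zero]
    exact rename_id_apply _
  | succ i ih => rw [hsucc, ih, ← hT, chainShift_X]
  | pred i ih =>
    refine chainShift_injective ?_
    rw [← hsucc, ← hT, chainShift_X, sub_add_cancel, ih]

/-- The derivative of `Φ_{n,m}` along a field that acts as `D` on every column. The two terms of
`Φ_{n,m}` are the Miura transformations of the columns `n` and `n + 1`. -/
theorem sum_mul_latticeDeriv_discreteEq (D : ChainField) (β : ℂ) (n m : ℤ) :
    ∑ i ∈ ({0, 1} : Finset ℤ), ∑ j ∈ ({0, 1} : Finset ℤ),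
      chainAt (n + i) (D (X (m + j))) * latticeDeriv (n + i) (m + j) (discreteEq β n m) =
    chainAt n (D (miura 1 (X m))) - C β * chainAt (n + 1) (D (miura (-1) (X m))) := by
  have hv : ∀ i j k l : ℤ, latticeDeriv i j (latticeVar k l) =
      if k = i ∧ l = j then 1 else 0 := fun i j k l => by
    rw [latticeDeriv, latticeVar, pderiv_X, Pi.single_apply]
    simp only [Prod.mk.injEq]
  have hd : ∀ i j : ℤ, latticeDeriv i j (discreteEq β n m) =
      latticeDeriv i j (latticeVar n (m + 1)) * (latticeVar n m - 1)
        + (latticeVar n (m + 1) + 1) * latticeDeriv i j (latticeVar n m)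
        - C β * (latticeDeriv i j (latticeVar (n + 1) (m + 1)) * (latticeVar (n + 1) m + 1)
        + (latticeVar (n + 1) (m + 1) - 1) * latticeDeriv i j (latticeVar (n + 1) m)) :=
    fun i j => by
      simp only [latticeDeriv, discreteEq, map_sub, map_add, pderiv_mul, pderiv_C, pderiv_one]
      ring
  rw [Finset.sum_pair zero_ne_one, Finset.sum_pair zero_ne_one, Finset.sum_pair zero_ne_one]
  simp only [hd, hv, miura_X, Derivation.leibniz, map_add, map_sub, map_mul, smul_eq_mul,
    chainAt_X, add_zero, map_one, map_neg]
  simp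
  ring

theorem eval_chainAt_miura (u : ℤ × ℤ → ℂ) (ε : ℂ) (n : ℤ) (P : ChainPoly) :
    eval u (chainAt n (miura ε P)) =
      eval (fun j => (u (n, j + 1) + ε) * (u (n, j) - ε)) P := by
  induction P using MvPolynomial.induction_on with
  | C a => simp
  | add p q hp hq => simp only [map_add, hp, hq]
  | mul_X p i hp =>
    rw [map_mul, map_mul, map_mul, map_mul, hp, miura_X]
    simp [latticeVar]

theorem isHomogeneous_volterraFlow (k : ℕ) (m : ℤ) :
    (volterraFlow k (X m)).IsHomogeneous (k + 2) := by
  refine isHomogeneous_of_eulerField ?_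
  have h := congrArg (fun D : ChainField => D (X m)) (euler_lie_volterraFlow k)
  simp only [Derivation.commutator_apply, Derivation.smul_apply, eulerField_X] at h
  rw [sub_eq_iff_eq_add.1 h]
  push_cast
  module

/-! ### The symmetries of the discrete equation -/

theorem isGeneralizedSymmetryM_symFlow {β : ℂ} {k : ℕ} (hβ : β ^ (k + 1) = 1) :
    IsGeneralizedSymmetryM (discreteEq β) (fun n m => chainAt n (symFlow k (X m))) (k + 1) where
  order_pos := k.succ_pos
  dependence n m p hp := by
    obtain ⟨j, hj, rfl⟩ := mem_vars_rename _ _ hp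
    have := Finset.mem_Icc.1 (isLocal_symFlow k m hj)
    exact ⟨rfl, this.1, this.2⟩
  upper := ⟨0, 0, fun h => by
    rw [latticeDeriv_chainAt] at h
    have h1 := rename_injective _ (prodMk_injective 0) (h.trans (map_zero _).symm)
    have h2 := eval_pderiv_symFlow_top k 0
    push_cast at h1
    rw [h1, map_zero] at h2
    exact mul_ne_zero (pow_ne_zero _ (by norm_num)) (by exact_mod_cast k.factorial_ne_zero) h2.symm⟩
  lower := ⟨0, 0, fun h => by
    rw [latticeDeriv_chainAt] at h
    have h1 := rename_injective _ (prodMk_injective 0) (h.trans (map_zero _).symm)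
    have h2 := eval_pderiv_symFlow_bottom k 0
    push_cast at h1
    rw [h1, map_zero] at h2
    exact mul_ne_zero (pow_ne_zero _ (by norm_num)) (by exact_mod_cast k.factorial_ne_zero) h2.symm⟩
  compatible u hu n m := by
    -- On solutions the two Miura transforms are related by the scaling `w ↦ β w`.
    have hw : (fun j => (u (n, j + 1) + 1) * (u (n, j) - 1)) =
        fun j => β * ((u (n + 1, j + 1) + -1) * (u (n + 1, j) - -1)) := by
      funext j
      have := hu n j
      simp only [discreteEq, latticeVar, map_sub, map_mul, map_add, eval_X, eval_C, map_one] at this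
      linear_combination this
    rw [sum_mul_latticeDeriv_discreteEq, intertwines_miura_symFlow (one_pow 2),
      intertwines_miura_symFlow (by norm_num), map_sub, map_mul, eval_C, eval_chainAt_miura,
      eval_chainAt_miura, hw, eval_mul_of_isHomogeneous (isHomogeneous_volterraFlow k m),
      pow_succ, hβ, one_mul, sub_self]

theorem isAutonomous_chainAt {D : ChainField} (hT : Intertwines chainShift D D) :
    IsAutonomous fun n m => chainAt n (D (X m)) := fun n m => by
  simp only [← rename_add_eq_of_intertwines hT m, chainAt, rename_rename]
  congr 2
  funext j
  simp

end

theorem mainTheorem4 (N : ℕ) (hN : 2 ≤ N) (β : ℂ) (hβ : IsPrimitiveRoot β N)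
    (κ : ℕ) (hκ : 1 ≤ κ) :
    (∀ n : ℤ, β ^ (n * ((κ * N : ℕ) : ℤ)) = 1) ∧
      IsGeneralizedSymmetryM (discreteEq β) (symRhs β (κ * N)) (κ * N) ∧
      IsAutonomous (symRhs β (κ * N)) := by
  have hpow : β ^ (κ * N) = 1 := by rw [mul_comm, pow_mul, hβ.pow_eq_one, one_pow]
  have hz : ∀ n : ℤ, β ^ (n * ((κ * N : ℕ) : ℤ)) = 1 := fun n => by
    rw [mul_comm, zpow_mul, zpow_natCast, hpow, one_zpow]
  refine ⟨hz, ?_⟩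
  obtain ⟨k, hk⟩ : ∃ k, κ * N = k + 1 :=
    Nat.exists_eq_succ_of_ne_zero (Nat.mul_ne_zero (by omega) (by omega))
  rw [hk] at hpow hz ⊢
  have h : symRhs β (k + 1) = fun n m => chainAt n (symFlow k (X m)) := by
    funext n m
    rw [symRhs_succ, hz, C_1, one_mul]
  rw [h]
  exact ⟨isGeneralizedSymmetryM_symFlow hpow, isAutonomous_chainAt (intertwines_shift_symFlow k)⟩
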